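/- **Setting.** Let $A\ge 1$ and let $\nu=(\nu_a)_{a=1}^A$ be a bandit with missing rewards: $\nu_a$ is the joint law of the reward $R_a\in\mathbb R$ and the indicator $C_a\in\{0,1\}$ of the reward *not* being missing. Put $\theta_a=\mathbb E[R_a]$ and $\overline\theta=\max_a\theta_a$. For fixed $\sigma_1,\dots,\sigma_A>0$ let $\mathcal C_1$ be the class of bandits such that, for each $a$, $C_a$ and $R_a$ are independent, $C_a$ is Bernoulli with parameter $q_a\in(0,1]$, and $\mathbb E[e^{s(R_a-\theta_a)}]\le e^{s^2\sigma_a^2/2}$ for all $s\in\mathbb R$. Let $\bar\sigma=\max_a\sigma_a$. First every arm is pulled once (round $0$). Then, in each round $t=1,\dots,T$, the decision-maker pulls an arm $A_t$ chosen on the basis of the past feedback (and possibly of independent randomization); a fresh $(R_{A_t,t},C_{A_t,t})\sim\nu_{A_t}$ is drawn, and the reward is observed only if $C_{A_t,t}=1$. Let $P_a(t)$ and $N_a(t)$ be the numbers of pulls and of observed rewards of arm $a$ before round $t$, including round $0$, and let $S_a(t)$ be the sum of these observed rewards. For parameters $\lambda>0$, $\delta\in(0,1)$ and $\overline K\ge\overline\theta$,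 let $$\underline q_\lambda=\min_{1\le a\le A,\ 1\le t\le T}\frac{N_a(t)+\lambda}{P_a(t)+\lambda}.$$ The regularized UCB algorithm pulls in round $t$ an arm $A_t$ that maximizes (ties broken arbitrarily) $$\frac{S_a(t)}{N_a(t)+\lambda}+\frac{\bar\sigma}{\hat q_t}\sqrt{\frac{2\ln(2AT/\delta)}{P_a(t)+\lambda}}+\frac{\lambda\overline K}{N_a(t)+\lambda},$$ where $\hat q_t$ is the value used for $\underline q_\lambda$ in round $t$: any value with $\underline q_\lambda\le\hat q_t\le\min_a\frac{N_a(t)+\lambda}{P_a(t)+\lambda}$, for example the running minimum $\min_{a,\,s\le t}\frac{N_a(s)+\lambda}{P_a(s)+\lambda}$, or $\underline q_\lambda$ itself if it is given to the algorithm. The pseudo-regret, including the initial pulls, is $$\mathsf{Regret}_T=\sum_{a=1}^A(\overline\theta-\theta_a)+\sum_{t=1}^T(\overline\theta-\theta_{A_t}).$$ **Theorem.** Fix $A$, $\sigma_1,\dots,\sigma_A>0$, $\overline K,B\in\mathbb R$, $\kappa>0$ and positive numbers $\lambda_T$ with $\lambda_T=o(\sqrt T)$. There are a constant $M$ and a sequence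 $r_T=o(\sqrt T)$ such that for every $\delta_1\in(0,1)$, every $T\ge1$ and every bandit $\nu\in\mathcal C_1$ with $-B\le\theta_a\le\overline K$ for all $a$, the regularized UCB algorithm with $\lambda=\lambda_T$ and $\delta=\delta_1$ satisfies $$\mathsf{Regret}_T\le\frac{4\bar\sigma}{\underline q_{\lambda_T}}\sqrt{2AT\ln(2AT/\delta_1)}+r_T+A\overline K$$ with probability at least $1-\delta_1-MT^{-\kappa}$. -/

import Mathlib

open MeasureTheory ProbabilityTheory Filter Asymptotics

noncomputable section

namespace MissingBandit

/-! ### Bandits with missing rewards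

An arm is a joint law `ν a` of the pair `(R, C)`: the reward `R`, and the indicator `C` (a Boolean)
of the reward *not* being missing. -/

/-- The mean reward `θ_a` of arm `a`. -/
def meanReward {A : ℕ} (ν : Fin A → Measure (ℝ × Bool)) (a : Fin A) : ℝ :=
  ∫ z, z.1 ∂(ν a)

/-- The best mean reward, the maximum of the `θ_a`. -/
def bestMean {A : ℕ} (ν : Fin A → Measure (ℝ × Bool)) : ℝ :=
  ⨆ a, meanReward ν a

/-- A law on `ℝ` is sub-Gaussian with variance proxy (at most) `σ²` if its centred version `x - m`,
`m` being its mean, satisfies `E exp (s (x - m)) ≤ exp (σ² s² / 2)` for all real `s`. -/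
def IsSubgaussianLaw (σ : ℝ) (ρ : Measure ℝ) : Prop :=
  HasSubgaussianMGF (fun x => x - ∫ y, y ∂ρ) (Real.toNNReal (σ ^ 2)) ρ

/-- The class of bandits with `σ_a`-sub-Gaussian rewards and reward-independent missingness: the
reward marginal is sub-Gaussian, the marginal of `C` is Bernoulli with `q_a ∈ (0, 1]`, and the two
coordinates are independent. -/
structure MemClassOne {A : ℕ} (σ : Fin A → ℝ) (ν : Fin A → Measure (ℝ × Bool)) : Prop where
  reward : ∀ a, IsSubgaussianLaw (σ a) ((ν a).map Prod.fst)
  observed : ∀ a, ∃ q : unitInterval, 0 < q ∧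
    (ν a).map Prod.snd = bernoulliMeasure true false q
  indep : ∀ a, ν a = ((ν a).map Prod.fst).prod ((ν a).map Prod.snd)

/-- The largest standard-deviation proxy `σ̄ = √(max_a σ_a²)`. -/
def sigmaBar {A : ℕ} (σ : Fin A → ℝ) : ℝ :=
  Real.sqrt (⨆ a, σ a ^ 2)

/-! ### Statistics along one trajectory

`act t` is the arm pulled in round `t ≥ 1`; `R a t`, `C a t` are the reward and the observation
indicator of arm `a` in round `t`. Round `0` is the initialization, where every arm is pulled once.
All counts are taken at the beginning of round `t`, so they cover the initial pull and the
rounds `1, …, t - 1`. -/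

/-- `P_a(t)`: the number of pulls of arm `a`. -/
def pulls {A : ℕ} (act : ℕ → Fin A) (a : Fin A) (t : ℕ) : ℝ :=
  1 + ∑ l ∈ Finset.Ico 1 t, if act l = a then 1 else 0

/-- `N_a(t)`: the number of observed rewards of arm `a`. -/
def observations {A : ℕ} (act : ℕ → Fin A) (C : Fin A → ℕ → Bool) (a : Fin A) (t : ℕ) : ℝ :=
  (if C a 0 then 1 else 0) +
    ∑ l ∈ Finset.Ico 1 t, if act l = a then (if C a l then 1 else 0) else 0

/-- The sum of the observed rewards of arm `a`. -/
def observedSum {A : ℕ} (act : ℕ → Fin A) (C : Fin A → ℕ → Bool) (R : Fin A → ℕ → ℝ)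
    (a : Fin A) (t : ℕ) : ℝ :=
  (if C a 0 then R a 0 else 0) +
    ∑ l ∈ Finset.Ico 1 t, if act l = a then (if C a l then R a l else 0) else 0

/-- The regularized mean reward estimate of arm `a`. -/
def estimate {A : ℕ} (lam : ℝ) (act : ℕ → Fin A) (C : Fin A → ℕ → Bool) (R : Fin A → ℕ → ℝ)
    (a : Fin A) (t : ℕ) : ℝ :=
  observedSum act C R a t / (observations act C a t + lam)

/-- The regularized observation frequency `(N_a(t) + λ) / (P_a(t) + λ)`. -/
def obsRatio {A : ℕ} (lam : ℝ) (act : ℕ → Fin A) (C : Fin A → ℕ → Bool)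
    (a : Fin A) (t : ℕ) : ℝ :=
  (observations act C a t + lam) / (pulls act a t + lam)

/-- `q_λ`: the infimum of the regularized observation frequencies over all arms and all rounds
`1, …, T`. -/
def qLam {A : ℕ} (lam : ℝ) (T : ℕ) (act : ℕ → Fin A) (C : Fin A → ℕ → Bool) : ℝ :=
  ⨅ p : Fin A × Set.Icc 1 T, obsRatio lam act C p.1 p.2

/-- The bonus `(σ̄ / q) √(2 ln (2AT/δ) / (P_a(t) + λ)) + λ K̄ / (N_a(t) + λ)`, with the value `q`
plugged in for `q_λ`. -/
def bonus {A : ℕ} (sbar lam Kbar delta : ℝ) (T : ℕ) (q : ℝ) (act : ℕ → Fin A)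
    (C : Fin A → ℕ → Bool) (a : Fin A) (t : ℕ) : ℝ :=
  sbar / q * Real.sqrt (2 * Real.log (2 * A * T / delta) / (pulls act a t + lam)) +
    lam * Kbar / (observations act C a t + lam)

/-- The optimistic mean reward estimate of arm `a`. -/
def optimistic {A : ℕ} (sbar lam Kbar delta : ℝ) (T : ℕ) (q : ℝ) (act : ℕ → Fin A)
    (C : Fin A → ℕ → Bool) (R : Fin A → ℕ → ℝ) (a : Fin A) (t : ℕ) : ℝ :=
  estimate lam act C R a t + bonus sbar lam Kbar delta T q act C a t

/-- The pseudo-regret `∑_{t=1}^T (θ̄ - θ_{A_t})` of the rounds `1, …, T`. -/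
def regret {A : ℕ} (ν : Fin A → Measure (ℝ × Bool)) (T : ℕ) (act : ℕ → Fin A) : ℝ :=
  ∑ t ∈ Finset.Icc 1 T, (bestMean ν - meanReward ν (act t))

/-- The pseudo-regret of the initialization, which pulls every arm once. -/
def initRegret {A : ℕ} (ν : Fin A → Measure (ℝ × Bool)) : ℝ :=
  ∑ a, (bestMean ν - meanReward ν a)

/-! ### Interaction and algorithm -/

/-- `IsInteraction ν T μ ℱ act R C`: under `μ`, the processes `act`, `R`, `C` describe a
decision-maker interacting with the bandit `ν` over an initialization and `T` rounds. The σ-algebra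
`ℱ t` is the information on which the decision-maker may base the choice in round `t`; it contains
the feedback received so far (the indicator, and the reward where it is not missing) and possibly
more, such as randomization used to break ties. Each `(R a t, C a t)` has law `ν a`, and the draws of
round `t` are independent of `ℱ t`. (Independence between the arms within one round is not asked
for.) -/
structure IsInteraction {A : ℕ} (ν : Fin A → Measure (ℝ × Bool)) (T : ℕ)
    {Ω : Type*} [mΩ : MeasurableSpace Ω] (μ : Measure Ω) (ℱ : Filtration ℕ mΩ)
    (act : ℕ → Ω → Fin A) (R : Fin A → ℕ → Ω → ℝ) (C : Fin A → ℕ → Ω → Bool) : Prop where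
  measurable_R : ∀ a, ∀ t ≤ T, Measurable (R a t)
  measurable_C : ∀ a, ∀ t ≤ T, Measurable (C a t)
  /-- Each draw of arm `a` has law `ν a`. -/
  law : ∀ a, ∀ t ≤ T, μ.map (fun ω => (R a t ω, C a t ω)) = ν a
  /-- The choice in round `t` uses the information available at its beginning only. -/
  act_measurable : ∀ t, 1 ≤ t → t ≤ T → Measurable[ℱ t] (act t)
  /-- The draws of round `t` are independent of the information available at its beginning. -/
  indep : ∀ t, 1 ≤ t → t ≤ T →
    Indep (MeasurableSpace.comap (fun ω a => (R a t ω, C a t ω)) inferInstance) (ℱ t) μ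
  /-- The feedback of the initialization is known at the beginning of round `1`. -/
  init_feedback : ∀ a,
    Measurable[ℱ 1] (fun ω => (C a 0 ω, if C a 0 ω then R a 0 ω else 0))
  /-- The feedback of round `t` is known at the beginning of round `t + 1`. -/
  feedback : ∀ t, 1 ≤ t → t ≤ T →
    Measurable[ℱ (t + 1)]
      (fun ω => (C (act t ω) t ω, if C (act t ω) t ω then R (act t ω) t ω else 0))

/-- `act` follows the regularized UCB algorithm along one trajectory: in each round `t = 1, …, T`,
the pulled arm maximizes the optimistic estimate (ties are broken arbitrarily). The number `q_λ`
in the bonus is a function of the whole trajectory, so the value `qhat t` used for it in round `t` may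
be anything between `q_λ` and the current regularized observation frequencies: for instance
the running minimum of these frequencies, or `q_λ` itself if it is given to the algorithm. -/
def FollowsUCB {A : ℕ} (sbar lam Kbar delta : ℝ) (T : ℕ) (qhat : ℕ → ℝ) (act : ℕ → Fin A)
    (C : Fin A → ℕ → Bool) (R : Fin A → ℕ → ℝ) : Prop :=
  ∀ t, 1 ≤ t → t ≤ T →
    qLam lam T act C ≤ qhat t ∧
    (∀ a, qhat t ≤ obsRatio lam act C a t) ∧
    ∀ a, optimistic sbar lam Kbar delta T (qhat t) act C R a t ≤
      optimistic sbar lam Kbar delta T (qhat t) act C R (act t) t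

end MissingBandit

end

/-! The only random input is a concentration event: for every arm and round, the compensated sum
`S_a(t) - N_a(t) θ_a` is at most `σ̄ √(2 L P_a(t))` in absolute value, with `L = ln (2AT/δ)`. On it
the regret bound is deterministic.

Since `P_a(t)` is random, `truncSum` stops the sum after a fixed number `n` of pulls. Each draw is
independent of the past, and a missing reward contributes 0, so the stopped sum carries an
exponential supermartingale and is sub-Gaussian with proxy `n σ̄²`. When `P_a(t) = n`, it is the
deviation at round `t`. A union bound over arms, values `1 ≤ n ≤ T` and two signs costs exactly `δ`,
so `M = 0` suffices.

On the event, `q ≤ (N + λ)/(P + λ)` turns the deviation into the confidence width, and the term `λ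
K̄/(N + λ)` overcompensates the shrinkage bias, so the index is optimistic (`gap_le`). The gap of an
arm is the same at each of its pulls; hence all of them are bounded through its last pull, where the
width is smallest (`card_mul_gap_le`). Cauchy–Schwarz over the arms gives `(2 σ̄ √(2ATL) + A λ (K̄ +
B))/q`.

The leading constant is thus 2, half of the claimed 4. The spare `2 σ̄ √(2ATL)/q` absorbs the bias
for large `T`, because `λ_T = o(√T)`. The finitely many other `T` go into `remainder`, through the
deterministic bound `1/q ≤ (T + λ)/λ`. -/

namespace MissingBandit

/-! ### Deterministic analysis of one trajectory -/

section Trajectory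

variable {A : ℕ} (act : ℕ → Fin A) (C : Fin A → ℕ → Bool) (R : Fin A → ℕ → ℝ) (a : Fin A)

lemma pulls_succ {t : ℕ} (ht : 1 ≤ t) :
    pulls act a (t + 1) = pulls act a t + if act t = a then 1 else 0 := by
  simp only [pulls, Finset.sum_Ico_succ_top ht, add_assoc]

lemma pulls_mono {s t : ℕ} (hst : s ≤ t) : pulls act a s ≤ pulls act a t := by
  refine add_le_add_right (Finset.sum_le_sum_of_subset_of_nonneg
    (Finset.Ico_subset_Ico_right hst) fun l _ _ => ?_) 1
  split_ifs <;> norm_num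

lemma pulls_eq_card (t : ℕ) :
    pulls act a t = ((1 + ((Finset.Ico 1 t).filter (fun l => act l = a)).card : ℕ) : ℝ) := by
  simp [pulls]

lemma one_le_pulls (t : ℕ) : 1 ≤ pulls act a t := by
  rw [pulls_eq_card]; push_cast; linarith [Nat.cast_nonneg (α := ℝ)
    ((Finset.Ico 1 t).filter (fun l => act l = a)).card]

lemma exists_pulls_eq {t : ℕ} (ht : 1 ≤ t) :
    ∃ n : ℕ, 1 ≤ n ∧ n ≤ t ∧ pulls act a t = n := by
  refine ⟨_, Nat.le_add_right 1 _, ?_, pulls_eq_card act a t⟩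
  have := Finset.card_filter_le (Finset.Ico 1 t) (fun l => act l = a)
  rw [Nat.card_Ico] at this
  omega

lemma observations_nonneg (t : ℕ) : 0 ≤ observations act C a t := by
  refine add_nonneg (by split_ifs <;> norm_num) (Finset.sum_nonneg fun l _ => ?_)
  split_ifs <;> norm_num

lemma obsRatio_ge {lam : ℝ} (hlam : 0 < lam) {T t : ℕ} (ht : 1 ≤ t) (htT : t ≤ T) :
    lam / (T + lam) ≤ obsRatio lam act C a t := by
  obtain ⟨n, hn, hnt, hP⟩ := exists_pulls_eq act a ht
  have h : (n : ℝ) ≤ T := by exact_mod_cast hnt.trans htT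
  have hN := observations_nonneg act C a t
  rw [obsRatio, hP]
  gcongr
  linarith

/-- A crude floor independent of the data: no observation at all in at most `T` pulls. It makes
divisions by `q` legitimate and bounds the bias for small `T`. -/
lemma qLam_ge (hA : 0 < A) {lam : ℝ} (hlam : 0 < lam) {T : ℕ} (hT : 1 ≤ T) :
    lam / (T + lam) ≤ qLam lam T act C := by
  have : Nonempty (Fin A × Set.Icc 1 T) := ⟨⟨⟨0, hA⟩, ⟨1, le_rfl, hT⟩⟩⟩
  exact le_ciInf fun p => obsRatio_ge act C p.1 hlam p.2.2.1 p.2.2.2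

lemma qLam_pos (hA : 0 < A) {lam : ℝ} (hlam : 0 < lam) {T : ℕ} (hT : 1 ≤ T) :
    0 < qLam lam T act C :=
  lt_of_lt_of_le (by positivity) (qLam_ge act C hA hlam hT)

variable {act C R}

/-- The deviation of the observed sum from its compensator stays within the confidence width. -/
def Concentrated (θ : Fin A → ℝ) (sbar L : ℝ) (T : ℕ) (act : ℕ → Fin A) (C : Fin A → ℕ → Bool)
    (R : Fin A → ℕ → ℝ) : Prop :=
  ∀ a t, 1 ≤ t → t ≤ T → |observedSum act C R a t - observations act C a t * θ a| ≤
    sbar * Real.sqrt (2 * L * pulls act a t)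

/-- The half-width used by the bonus dominates the normalized deviation width. -/
lemma width_le {sbar lam L q : ℝ} (hs : 0 ≤ sbar) (hlam : 0 < lam)
    (hL : 0 ≤ L) (hq : 0 < q) {t : ℕ} (hqr : q ≤ obsRatio lam act C a t) :
    sbar * Real.sqrt (2 * L * pulls act a t) / (observations act C a t + lam) ≤
      sbar / q * Real.sqrt (2 * L / (pulls act a t + lam)) := by
  have hP := one_le_pulls act a t
  have hN := observations_nonneg act C a t
  -- In the form `q (P + λ) ≤ N + λ`, the hypothesis trades the observation count for the pull
  -- count.
  rw [obsRatio, le_div_iff₀ (by linarith)] at hqr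
  have hPl : 0 < pulls act a t + lam := by linarith
  have hNl : 0 < observations act C a t + lam := by linarith
  have h1 : Real.sqrt (2 * L * pulls act a t) ≤
      (pulls act a t + lam) * Real.sqrt (2 * L / (pulls act a t + lam)) := by
    rw [Real.sqrt_le_left (by positivity), mul_pow, Real.sq_sqrt (by positivity)]
    have : (pulls act a t + lam) ^ 2 * (2 * L / (pulls act a t + lam)) =
        2 * L * (pulls act a t + lam) := by field_simp
    rw [this]
    gcongr
    linarith
  rw [div_mul_eq_mul_div, div_le_div_iff₀ hNl hq, mul_assoc sbar, mul_assoc sbar]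
  refine mul_le_mul_of_nonneg_left ?_ hs
  calc _ ≤ (pulls act a t + lam) * Real.sqrt (2 * L / (pulls act a t + lam)) * q := by gcongr
    _ = (q * (pulls act a t + lam)) * Real.sqrt (2 * L / (pulls act a t + lam)) := by ring
    _ ≤ (observations act C a t + lam) * Real.sqrt (2 * L / (pulls act a t + lam)) := by gcongr
    _ = _ := by ring

variable {θ : Fin A → ℝ} {sbar lam Kbar delta : ℝ} {T : ℕ} {qhat : ℕ → ℝ}

/-- Optimism: shrinkage by `λ` biases the estimate by `-λ θ/(N + λ)`, and adding `λ K̄/(N + λ)`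
leaves `λ (K̄ - θ)/(N + λ) ≥ 0`. This surplus is dropped for `b` and paid for by the pulled arm. -/
lemma gap_le (hA : 0 < A) (hs : 0 ≤ sbar) (hlam : 0 < lam)
    (hL : 0 ≤ Real.log (2 * A * T / delta)) (hK : ∀ a, θ a ≤ Kbar)
    (hconc : Concentrated θ sbar (Real.log (2 * A * T / delta)) T act C R)
    (hucb : FollowsUCB sbar lam Kbar delta T qhat act C R)
    {t : ℕ} (ht : 1 ≤ t) (htT : t ≤ T) (b : Fin A) :
    θ b - θ (act t) ≤
      2 * (sbar / qhat t *
        Real.sqrt (2 * Real.log (2 * A * T / delta) / (pulls act (act t) t + lam))) +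
      lam * (Kbar - θ (act t)) / (observations act C (act t) t + lam) := by
  obtain ⟨hq1, hq2, hmax⟩ := hucb t ht htT
  have hq : 0 < qhat t := (qLam_pos act C hA hlam (ht.trans htT)).trans_le hq1
  have dev : ∀ c, |(observedSum act C R c t - observations act C c t * θ c) /
      (observations act C c t + lam)| ≤ sbar / qhat t *
        Real.sqrt (2 * Real.log (2 * A * T / delta) / (pulls act c t + lam)) := fun c => by
    have hN := observations_nonneg act C c t
    rw [abs_div, abs_of_pos (by linarith : 0 < observations act C c t + lam)]
    refine le_trans ?_ (width_le c hs hlam hL hq (hq2 c))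
    gcongr
    exact hconc c t ht htT
  have split : ∀ c, estimate lam act C R c t + lam * Kbar / (observations act C c t + lam) =
      θ c + (observedSum act C R c t - observations act C c t * θ c) /
        (observations act C c t + lam) +
      lam * (Kbar - θ c) / (observations act C c t + lam) := fun c => by
    have hN := observations_nonneg act C c t
    have : observations act C c t + lam ≠ 0 := by positivity
    rw [estimate]
    field_simp
    ring
  have hb := hmax b
  simp only [optimistic, bonus] at hb
  have nonneg_b : 0 ≤ lam * (Kbar - θ b) / (observations act C b t + lam) := by
    have hN := observations_nonneg act C b t
    have := sub_nonneg.2 (hK b)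
    positivity
  linarith [split b, split (act t), (abs_le.1 (dev b)).1, (abs_le.1 (dev (act t))).2]

/-- All pulls of one arm are controlled through the last of them. -/
lemma card_mul_gap_le (hA : 0 < A) (hs : 0 ≤ sbar) (hlam : 0 < lam)
    (hL : 0 ≤ Real.log (2 * A * T / delta)) (hK : ∀ a, θ a ≤ Kbar) {B : ℝ} (hB : ∀ a, -B ≤ θ a)
    (hconc : Concentrated θ sbar (Real.log (2 * A * T / delta)) T act C R)
    (hucb : FollowsUCB sbar lam Kbar delta T qhat act C R) (hT : 1 ≤ T) (b : Fin A) :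
    (((Finset.Icc 1 T).filter (fun t => act t = a)).card : ℝ) * (θ b - θ a) ≤
      (2 * sbar * Real.sqrt (2 * Real.log (2 * A * T / delta)) *
        Real.sqrt (((Finset.Icc 1 T).filter (fun t => act t = a)).card) + lam * (Kbar + B)) /
        qLam lam T act C := by
  set S := (Finset.Icc 1 T).filter (fun t => act t = a) with hS
  set L := Real.log (2 * A * T / delta)
  have hqpos := qLam_pos act C hA hlam hT
  have hKB : 0 ≤ Kbar + B := by linarith [hK a, hB a]
  rcases S.eq_empty_or_nonempty with h0 | hne
  · rw [h0]; simp; positivity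
  obtain ⟨ht, hmax⟩ := And.intro (S.max'_mem hne) (fun l hl => S.le_max' l hl)
  set t := S.max' hne
  simp only [hS, Finset.mem_filter, Finset.mem_Icc] at ht hmax
  obtain ⟨⟨ht1, htT⟩, hta⟩ := ht
  -- At the last pull, the count omits that pull but includes the initial one, so it equals the
  -- number of pulls in rounds `1, …, T` exactly.
  have hP : pulls act a t = S.card := by
    have : S = insert t ((Finset.Ico 1 t).filter (fun l => act l = a)) := by
      ext l
      simp only [hS, Finset.mem_filter, Finset.mem_Icc, Finset.mem_insert, Finset.mem_Ico]
      constructor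
      · rintro ⟨h1, h2⟩
        have := hmax l ⟨h1, h2⟩
        rcases this.eq_or_lt with h | h
        · exact Or.inl h
        · exact Or.inr ⟨⟨h1.1, h⟩, h2⟩
      · rintro (rfl | ⟨h1, h2⟩)
        · exact ⟨⟨ht1, htT⟩, hta⟩
        · exact ⟨⟨h1.1, by omega⟩, h2⟩
    rw [pulls_eq_card, this, Finset.card_insert_of_notMem (by simp), add_comm]
  have hgap := gap_le hA hs hlam hL hK hconc hucb ht1 htT b
  rw [hta, hP] at hgap
  obtain ⟨hq1, hq2, -⟩ := hucb t ht1 htT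
  have hr := hq1.trans (hq2 a)
  have hN := observations_nonneg act C a t
  have hm : (0 : ℝ) < S.card := by exact_mod_cast hne.card_pos
  rw [obsRatio, hP, le_div_iff₀ (by positivity)] at hr
  set m : ℝ := (S.card : ℝ)
  set q := qLam lam T act C
  have hconf : m * (2 * (sbar / qhat t * Real.sqrt (2 * L / (m + lam)))) ≤
      2 * sbar * Real.sqrt (2 * L) * Real.sqrt m / q := by
    have hms : m * Real.sqrt (2 * L / (m + lam)) ≤ Real.sqrt (2 * L) * Real.sqrt m := by
      rw [← Real.sqrt_mul (by positivity)]
      refine Real.le_sqrt_of_sq_le ?_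
      rw [mul_pow, Real.sq_sqrt (by positivity), ← mul_div_assoc, div_le_iff₀ (by positivity)]
      nlinarith [mul_nonneg (mul_nonneg hL hm.le) hlam.le]
    calc _ = 2 * sbar / qhat t * (m * Real.sqrt (2 * L / (m + lam))) := by ring
      _ ≤ 2 * sbar / q * (Real.sqrt (2 * L) * Real.sqrt m) := by gcongr
      _ = _ := by ring
  have hbias : m * (lam * (Kbar - θ a) / (observations act C a t + lam)) ≤
      lam * (Kbar + B) / q := by
    have hKa : 0 ≤ Kbar - θ a := sub_nonneg.2 (hK a)
    -- From `q (m + λ) ≤ N + λ`: multiplying by the number of pulls cancels the decay of the bias,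
    -- which therefore costs `O(λ/q)` per arm.
    have : m / (observations act C a t + lam) ≤ 1 / q := by
      rw [div_le_div_iff₀ (by positivity) hqpos]
      nlinarith
    calc _ = lam * (Kbar - θ a) * (m / (observations act C a t + lam)) := by ring
      _ ≤ lam * (Kbar - θ a) * (1 / q) := by gcongr
      _ ≤ lam * (Kbar + B) * (1 / q) := by
        have := hB a
        gcongr
        linarith
      _ = _ := by ring
  calc m * (θ b - θ a) ≤ _ := mul_le_mul_of_nonneg_left hgap hm.le
    _ ≤ _ := by rw [mul_add, add_div]; exact add_le_add hconf hbias

/-- Cauchy–Schwarz, the fibre sizes adding up to `T`. -/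
lemma sum_sqrt_card_le (act : ℕ → Fin A) (T : ℕ) :
    ∑ a, Real.sqrt (((Finset.Icc 1 T).filter (fun t => act t = a)).card) ≤
      Real.sqrt (A * T) := by
  refine Real.le_sqrt_of_sq_le ?_
  refine (sq_sum_le_card_mul_sum_sq).trans ?_
  simp only [Real.sq_sqrt (Nat.cast_nonneg _), Finset.card_univ, Fintype.card_fin]
  rw [← Nat.cast_sum, ← Finset.card_eq_sum_card_fiberwise
      (fun _ _ => Finset.mem_coe.2 (Finset.mem_univ _)),
    Nat.card_Icc, Nat.add_sub_cancel]

lemma sum_gap_le (hA : 0 < A) (hs : 0 ≤ sbar) (hlam : 0 < lam)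
    (hL : 0 ≤ Real.log (2 * A * T / delta)) (hK : ∀ a, θ a ≤ Kbar) {B : ℝ} (hB : ∀ a, -B ≤ θ a)
    (hconc : Concentrated θ sbar (Real.log (2 * A * T / delta)) T act C R)
    (hucb : FollowsUCB sbar lam Kbar delta T qhat act C R) (hT : 1 ≤ T) (b : Fin A) :
    ∑ t ∈ Finset.Icc 1 T, (θ b - θ (act t)) ≤
      (2 * sbar * Real.sqrt (2 * A * T * Real.log (2 * A * T / delta)) +
        A * (lam * (Kbar + B))) / qLam lam T act C := by
  have hqpos := qLam_pos act C hA hlam hT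
  have hsum : ∑ t ∈ Finset.Icc 1 T, (θ b - θ (act t)) =
      ∑ a, (((Finset.Icc 1 T).filter (fun t => act t = a)).card : ℝ) * (θ b - θ a) := by
    rw [← Finset.sum_fiberwise (Finset.Icc 1 T) act]
    refine Finset.sum_congr rfl fun a _ => ?_
    rw [← nsmul_eq_mul]
    refine Finset.sum_eq_card_nsmul fun t ht => ?_
    rw [(Finset.mem_filter.1 ht).2]
  rw [hsum]
  refine (Finset.sum_le_sum fun a _ =>
    card_mul_gap_le a hA hs hlam hL hK hB hconc hucb hT b).trans ?_
  rw [← Finset.sum_div, Finset.sum_add_distrib, ← Finset.mul_sum]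
  simp only [Finset.sum_const, Finset.card_univ, Fintype.card_fin, nsmul_eq_mul]
  have hroot : Real.sqrt (2 * A * T * Real.log (2 * A * T / delta)) =
      Real.sqrt (2 * Real.log (2 * A * T / delta)) * Real.sqrt (A * T) := by
    rw [← Real.sqrt_mul (by positivity)]
    congr 1
    ring
  rw [hroot, ← mul_assoc (2 * sbar)]
  gcongr
  exact sum_sqrt_card_le act T

end Trajectory

/-! ### Stopping the deviations after a fixed number of pulls -/

/-- The centred reward `R - m` if it is observed, and `0` if it is missing. -/
noncomputable def centredFeedback (m : ℝ) (z : ℝ × Bool) : ℝ :=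
  if z.2 then z.1 - m else 0

lemma measurable_centredFeedback (m : ℝ) : Measurable (centredFeedback m) :=
  Measurable.ite (measurable_snd (measurableSet_singleton true))
    (measurable_fst.sub_const m) measurable_const

section Truncation

variable {A : ℕ}

/-- The centred observed rewards of arm `a` before round `t`, limited to its first `n` pulls. -/
noncomputable def truncSum (m : ℝ) (n : ℕ) (act : ℕ → Fin A) (C : Fin A → ℕ → Bool)
    (R : Fin A → ℕ → ℝ) (a : Fin A) (t : ℕ) : ℝ :=
  centredFeedback m (R a 0, C a 0) + ∑ l ∈ Finset.Ico 1 t,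
    if act l = a ∧ pulls act a l < n then centredFeedback m (R a l, C a l) else 0

/-- The number of the first `n` pulls of arm `a` that take place before round `t`. -/
noncomputable def truncCount (n : ℕ) (act : ℕ → Fin A) (a : Fin A) (t : ℕ) : ℝ :=
  1 + ∑ l ∈ Finset.Ico 1 t, if act l = a ∧ pulls act a l < n then 1 else 0

variable (m : ℝ) (n : ℕ) (act : ℕ → Fin A) (C : Fin A → ℕ → Bool) (R : Fin A → ℕ → ℝ) (a : Fin A)

lemma truncCount_le {n : ℕ} (hn : 1 ≤ n) {t : ℕ} (ht : 1 ≤ t) : truncCount n act a t ≤ n := by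
  -- The bound by `pulls` strengthens the induction: a new term is counted only if `pulls < n`, and
  -- then `pulls + 1 ≤ n` by integrality.
  suffices h : truncCount n act a t ≤ n ∧ truncCount n act a t ≤ pulls act a t from h.1
  induction t, ht using Nat.le_induction with
  | base => simpa [truncCount, pulls] using hn
  | succ t ht ih =>
    have hrec : truncCount n act a (t + 1) =
        truncCount n act a t + if act t = a ∧ pulls act a t < n then 1 else 0 := by
      simp only [truncCount, Finset.sum_Ico_succ_top ht, add_assoc]
    rw [hrec, pulls_succ act a ht]
    by_cases hact : act t = a
    · by_cases hp : pulls act a t < n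
      · obtain ⟨k, -, -, hk⟩ := exists_pulls_eq act a ht
        have : pulls act a t + 1 ≤ n := by
          rw [hk] at hp ⊢
          exact_mod_cast hp
        simp only [hact, hp, and_self, if_true]
        constructor <;> linarith
      · simp only [hp, and_false, if_false, add_zero, hact, if_true]
        exact ⟨ih.1, by linarith⟩
    · simp only [hact, false_and, if_false, add_zero]
      exact ih

lemma deviation_eq_sum (t : ℕ) :
    observedSum act C R a t - observations act C a t * m =
      centredFeedback m (R a 0, C a 0) + ∑ l ∈ Finset.Ico 1 t,
        if act l = a then centredFeedback m (R a l, C a l) else 0 := by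
  rw [observedSum, observations, add_mul, Finset.sum_mul, add_sub_add_comm,
    ← Finset.sum_sub_distrib]
  congr 1
  · simp only [centredFeedback]
    split_ifs <;> ring
  · refine Finset.sum_congr rfl fun l _ => ?_
    simp only [centredFeedback]
    split_ifs <;> ring

/-- The pulls before round `t` are exactly the first `n`, so truncation at `n` discards everything
from `t` to `T`. A deviation at a random count becomes a fixed-`n` variable at the final time, ready
for a union bound over `n`. -/
lemma deviation_eq_truncSum {t T : ℕ} (htT : t ≤ T)
    {n : ℕ} (hP : pulls act a t = n) :
    observedSum act C R a t - observations act C a t * m = truncSum m n act C R a T := by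
  rw [deviation_eq_sum, truncSum]
  congr 1
  rw [← Finset.sum_subset (Finset.Ico_subset_Ico_right htT)]
  · refine Finset.sum_congr rfl fun l hl => ?_
    obtain ⟨hl1, hlt⟩ := Finset.mem_Ico.1 hl
    by_cases hact : act l = a
    · have h1 := pulls_succ act a hl1
      have h2 := pulls_mono act a (Nat.succ_le_of_lt hlt)
      rw [if_pos hact] at h1
      rw [if_pos hact, if_pos ⟨hact, by rw [← hP]; simp only [Nat.succ_eq_add_one] at h2; linarith⟩]
    · rw [if_neg hact, if_neg (fun h => hact h.1)]
  · intro l hl hlt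
    have htl : t ≤ l := by
      by_contra h
      exact hlt (Finset.mem_Ico.2 ⟨(Finset.mem_Ico.1 hl).1, not_le.1 h⟩)
    exact if_neg fun h => absurd h.2 (not_lt.2 (hP ▸ pulls_mono act a htl))

end Truncation

/-! ### Exponential moment of one draw -/

section ClassOne

variable {A : ℕ} {σ : Fin A → ℝ} {ν : Fin A → Measure (ℝ × Bool)}

lemma sigmaBar_nonneg (σ : Fin A → ℝ) : 0 ≤ sigmaBar σ := Real.sqrt_nonneg _

lemma sq_le_sigmaBar_sq (σ : Fin A → ℝ) (a : Fin A) : σ a ^ 2 ≤ sigmaBar σ ^ 2 := by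
  have h := le_ciSup (f := fun a => σ a ^ 2) (Set.finite_range _).bddAbove a
  rw [sigmaBar, Real.sq_sqrt ((sq_nonneg (σ a)).trans h)]
  exact h

/-- Independence allows fixing the indicator and integrating the reward first: if missing, the
integrand is `exp (-c) ≤ 1`; if observed, this is the sub-Gaussian bound with `σ_a ≤ σ̄`. -/
lemma lintegral_exp_centredFeedback_le (hν : MemClassOne σ ν) (a : Fin A)
    [IsProbabilityMeasure (ν a)] (s : ℝ) :
    ∫⁻ z, ENNReal.ofReal (Real.exp (s * centredFeedback (meanReward ν a) z -
      s ^ 2 * sigmaBar σ ^ 2 / 2)) ∂(ν a) ≤ 1 := by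
  have : IsProbabilityMeasure ((ν a).map Prod.fst) :=
    Measure.isProbabilityMeasure_map measurable_fst.aemeasurable
  have : IsProbabilityMeasure ((ν a).map Prod.snd) :=
    Measure.isProbabilityMeasure_map measurable_snd.aemeasurable
  have hmean : ∫ y, y ∂((ν a).map Prod.fst) = meanReward ν a :=
    integral_map measurable_fst.aemeasurable aestronglyMeasurable_id
  have hsub := hν.reward a
  rw [IsSubgaussianLaw, hmean] at hsub
  set c := s ^ 2 * sigmaBar σ ^ 2 / 2
  have hc : 0 ≤ c := by positivity
  have hmeas : Measurable fun z => ENNReal.ofReal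
      (Real.exp (s * centredFeedback (meanReward ν a) z - c)) :=
    ((((measurable_centredFeedback _).const_mul s).sub_const c).exp).ennreal_ofReal
  rw [hν.indep a, lintegral_prod_symm _ hmeas.aemeasurable]
  have hinner : ∀ b : Bool, ∫⁻ x, ENNReal.ofReal
      (Real.exp (s * centredFeedback (meanReward ν a) (x, b) - c)) ∂((ν a).map Prod.fst) ≤ 1 := by
    rintro (_ | _)
    · simpa [centredFeedback] using hc
    · simp only [centredFeedback, if_true, Real.exp_sub]
      rw [← ofReal_integral_eq_lintegral_ofReal ((hsub.integrable_exp_mul s).div_const _)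
        (ae_of_all _ fun x => by positivity), ENNReal.ofReal_le_one, integral_div,
        div_le_one (Real.exp_pos _)]
      refine (hsub.mgf_le s).trans (Real.exp_le_exp.2 ?_)
      rw [Real.coe_toNNReal _ (sq_nonneg _), mul_comm]
      have := sq_le_sigmaBar_sq σ a
      show _ ≤ s ^ 2 * sigmaBar σ ^ 2 / 2
      gcongr
  calc _ ≤ ∫⁻ _, 1 ∂((ν a).map Prod.snd) := lintegral_mono hinner
    _ = 1 := by rw [lintegral_one, measure_univ]

end ClassOne

/-! ### Supermartingale and concentration -/

namespace IsInteraction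

variable {A : ℕ} {ν : Fin A → Measure (ℝ × Bool)} {T : ℕ} {Ω : Type*} [mΩ : MeasurableSpace Ω]
  {μ : Measure Ω} {ℱ : Filtration ℕ mΩ} {act : ℕ → Ω → Fin A} {R : Fin A → ℕ → Ω → ℝ}
  {C : Fin A → ℕ → Ω → Bool}

lemma measurable_pair (h : IsInteraction ν T μ ℱ act R C) (a : Fin A) {t : ℕ} (htT : t ≤ T) :
    Measurable fun ω => (R a t ω, C a t ω) :=
  (h.measurable_R a t htT).prodMk (h.measurable_C a t htT)

lemma measurable_act_of_le (h : IsInteraction ν T μ ℱ act R C) {l t : ℕ} (hl : 1 ≤ l) (hlT : l ≤ T)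
    (hlt : l ≤ t) : Measurable[ℱ t] (act l) :=
  (h.act_measurable l hl hlT).mono (ℱ.mono hlt) le_rfl

lemma measurable_pulls (h : IsInteraction ν T μ ℱ act R C) (a : Fin A) {t : ℕ} (htT : t ≤ T) :
    Measurable[ℱ t] fun ω => pulls (fun l => act l ω) a t := by
  refine Measurable.const_add (Finset.measurable_fun_sum _ fun l hl => ?_) 1
  obtain ⟨h1, h2⟩ := Finset.mem_Ico.1 hl
  exact Measurable.ite (h.measurable_act_of_le h1 (by omega) h2.le (measurableSet_singleton a))
    measurable_const measurable_const

lemma measurableSet_pull (h : IsInteraction ν T μ ℱ act R C) (a : Fin A) (n : ℕ) {t : ℕ}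
    (ht : 1 ≤ t) (htT : t ≤ T) :
    MeasurableSet[ℱ t] {ω | act t ω = a ∧ pulls (fun l => act l ω) a t < n} :=
  (h.act_measurable t ht htT (measurableSet_singleton a)).inter
    (h.measurable_pulls a htT measurableSet_Iio)

lemma measurable_truncSum (h : IsInteraction ν T μ ℱ act R C) (m : ℝ) (n : ℕ) (a : Fin A) {t : ℕ}
    (ht : 1 ≤ t) (htT : t ≤ T) :
    Measurable[ℱ t] fun ω =>
      truncSum m n (fun l => act l ω) (fun a l => C a l ω) (fun a l => R a l ω) a t := by
  have hg : Measurable fun z : Bool × ℝ => centredFeedback m (z.2, z.1) :=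
    (measurable_centredFeedback m).comp measurable_swap
  -- The centred feedback depends on the reward only where it is observed, hence only on information
  -- in the filtration.
  have key : ∀ (r : ℝ) (c : Bool), centredFeedback m (r, c) =
      centredFeedback m (if c then r else 0, c) := fun r c => by cases c <;> simp [centredFeedback]
  refine Measurable.add ?_ (Finset.measurable_fun_sum _ fun l hl => ?_)
  · simp only [key (R a 0 _)]
    exact (hg.comp (h.init_feedback a)).mono (ℱ.mono ht) le_rfl
  · obtain ⟨h1, h2⟩ := Finset.mem_Ico.1 hl
    have hfb : Measurable[ℱ t] fun ω =>
        centredFeedback m (if C (act l ω) l ω then R (act l ω) l ω else 0, C (act l ω) l ω) :=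
      (hg.comp (h.feedback l h1 (by omega))).mono (ℱ.mono h2) le_rfl
    have heq : (fun ω => if act l ω = a ∧ pulls (fun l => act l ω) a l < n then
          centredFeedback m (R a l ω, C a l ω) else 0) =
        fun ω => if act l ω = a ∧ pulls (fun l => act l ω) a l < n then
          centredFeedback m (if C (act l ω) l ω then R (act l ω) l ω else 0, C (act l ω) l ω)
          else 0 := by
      funext ω
      refine if_ctx_congr Iff.rfl (fun hω => ?_) fun _ => rfl
      rw [hω.1, key]
    rw [heq]
    exact Measurable.ite (ℱ.mono h2.le _ (h.measurableSet_pull a n h1 (by omega)))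
      hfb measurable_const

lemma measurable_truncCount (h : IsInteraction ν T μ ℱ act R C) (n : ℕ) (a : Fin A) {t : ℕ}
    (htT : t ≤ T) :
    Measurable[ℱ t] fun ω => truncCount n (fun l => act l ω) a t := by
  refine Measurable.const_add (Finset.measurable_fun_sum _ fun l hl => ?_) 1
  obtain ⟨h1, h2⟩ := Finset.mem_Ico.1 hl
  exact Measurable.ite (ℱ.mono h2.le _ (h.measurableSet_pull a n h1 (by omega)))
    measurable_const measurable_const

variable {σ : Fin A → ℝ} [IsProbabilityMeasure μ]

lemma lintegral_exp_draw_le (h : IsInteraction ν T μ ℱ act R C) (hν : MemClassOne σ ν) (a : Fin A)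
    {t : ℕ} (htT : t ≤ T) (s : ℝ) :
    ∫⁻ ω, ENNReal.ofReal (Real.exp (s * centredFeedback (meanReward ν a) (R a t ω, C a t ω) -
      s ^ 2 * sigmaBar σ ^ 2 / 2)) ∂μ ≤ 1 := by
  have hmeas := h.measurable_pair a htT
  have : IsProbabilityMeasure (ν a) := by
    rw [← h.law a t htT]
    exact Measure.isProbabilityMeasure_map hmeas.aemeasurable
  refine le_trans (le_of_eq ?_) (lintegral_exp_centredFeedback_le hν a s)
  rw [← h.law a t htT, lintegral_map ?_ hmeas]
  exact ((((measurable_centredFeedback _).const_mul s).sub_const _).exp).ennreal_ofReal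

/-- The exponential supermartingale of the truncated sums. -/
lemma lintegral_exp_truncSum_le (h : IsInteraction ν T μ ℱ act R C) (hν : MemClassOne σ ν)
    (a : Fin A) (n : ℕ) (s : ℝ) {t : ℕ} (ht : 1 ≤ t) (htT : t ≤ T) :
    ∫⁻ ω, ENNReal.ofReal (Real.exp (s * truncSum (meanReward ν a) n (fun l => act l ω)
      (fun a l => C a l ω) (fun a l => R a l ω) a t -
      s ^ 2 * sigmaBar σ ^ 2 / 2 * truncCount n (fun l => act l ω) a t)) ∂μ ≤ 1 := by
  induction t, ht using Nat.le_induction with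
  | base => simpa [truncSum, truncCount] using h.lintegral_exp_draw_le hν a (Nat.zero_le T) s
  | succ t ht ih =>
    have htT' : t ≤ T := by omega
    specialize ih htT'
    set c := s ^ 2 * sigmaBar σ ^ 2 / 2
    set W : Ω → ENNReal := fun ω => ENNReal.ofReal (Real.exp (s * truncSum (meanReward ν a) n
      (fun l => act l ω) (fun a l => C a l ω) (fun a l => R a l ω) a t -
      c * truncCount n (fun l => act l ω) a t)) with hW
    set Y : Ω → ENNReal := fun ω => ENNReal.ofReal
      (Real.exp (s * centredFeedback (meanReward ν a) (R a t ω, C a t ω) - c)) with hY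
    set I : Set Ω := {ω | act t ω = a ∧ pulls (fun l => act l ω) a t < n}
    have hWm : Measurable[ℱ t] W :=
      (((h.measurable_truncSum _ n a ht htT').const_mul s).sub
        ((h.measurable_truncCount n a htT').const_mul c)).exp.ennreal_ofReal
    have hIm : MeasurableSet[ℱ t] I := h.measurableSet_pull a n ht htT'
    have hYm : Measurable[MeasurableSpace.comap (fun ω a => (R a t ω, C a t ω)) inferInstance]
        Y := by
      have : Measurable fun z : Fin A → ℝ × Bool => ENNReal.ofReal
          (Real.exp (s * centredFeedback (meanReward ν a) (z a) - c)) :=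
        (((((measurable_centredFeedback _).comp (measurable_pi_apply a)).const_mul s).sub_const
          c).exp).ennreal_ofReal
      exact this.comp (comap_measurable _)
    have hle : MeasurableSpace.comap (fun ω a => (R a t ω, C a t ω)) inferInstance ≤ mΩ :=
      measurable_iff_comap_le.1 (measurable_pi_lambda _ fun b => h.measurable_pair b htT')
    -- On `I` the weight gains the factor `Y` of the fresh draw; off `I` it is unchanged. As `I` and
    -- `W` are known at round `t` and `Y` is independent of the past with integral at most 1, the
    -- total cannot grow.
    have hstep : ∀ ω, ENNReal.ofReal (Real.exp (s * truncSum (meanReward ν a) n (fun l => act l ω)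
        (fun a l => C a l ω) (fun a l => R a l ω) a (t + 1) -
        c * truncCount n (fun l => act l ω) a (t + 1))) =
        I.indicator W ω * Y ω + Iᶜ.indicator W ω := fun ω => by
      by_cases hω : ω ∈ I
      · rw [Set.indicator_of_mem hω, Set.indicator_of_notMem (by simpa using hω), add_zero, hW, hY,
          ← ENNReal.ofReal_mul (Real.exp_pos _).le, ← Real.exp_add]
        simp only [truncSum, truncCount, Finset.sum_Ico_succ_top ht]
        have hω' : act t ω = a ∧ pulls (fun l => act l ω) a t < n := hω
        rw [if_pos hω', if_pos hω']
        congr 2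
        ring
      · rw [Set.indicator_of_notMem hω, Set.indicator_of_mem (by simpa using hω), zero_mul,
          zero_add, hW]
        simp only [truncSum, truncCount, Finset.sum_Ico_succ_top ht]
        have hω' : ¬ (act t ω = a ∧ pulls (fun l => act l ω) a t < n) := hω
        rw [if_neg hω', if_neg hω', add_zero, add_zero]
    simp only [hstep]
    have hIm' := ℱ.le t _ hIm
    have hWm' : Measurable W := hWm.mono (ℱ.le t) le_rfl
    rw [lintegral_add_right _ (hWm'.indicator hIm'.compl),
      lintegral_mul_eq_lintegral_mul_lintegral_of_independent_measurableSpace (ℱ.le t) hle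
        (h.indep t ht htT').symm (hWm.indicator hIm) hYm]
    calc _ ≤ (∫⁻ ω, I.indicator W ω ∂μ) * 1 + ∫⁻ ω, Iᶜ.indicator W ω ∂μ := by
          gcongr
          exact h.lintegral_exp_draw_le hν a htT' s
      _ = ∫⁻ ω, W ω ∂μ := by
          rw [mul_one, lintegral_indicator hIm', lintegral_indicator hIm'.compl,
            lintegral_add_compl _ hIm']
      _ ≤ 1 := ih

/-- The supermartingale compensates by the random `truncCount`; replacing it by its upper bound `n`
gives a deterministic proxy. The bound on the lower integral also yields integrability. -/
lemma hasSubgaussianMGF_truncSum (h : IsInteraction ν T μ ℱ act R C) (hν : MemClassOne σ ν)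
    (hT : 1 ≤ T) (a : Fin A) {n : ℕ} (hn : 1 ≤ n) :
    HasSubgaussianMGF (fun ω => truncSum (meanReward ν a) n (fun l => act l ω)
      (fun a l => C a l ω) (fun a l => R a l ω) a T) (n * Real.toNNReal (sigmaBar σ ^ 2)) μ := by
  set Z : Ω → ℝ := fun ω => truncSum (meanReward ν a) n (fun l => act l ω)
      (fun a l => C a l ω) (fun a l => R a l ω) a T
  have hZ : Measurable Z := (h.measurable_truncSum _ n a hT le_rfl).mono (ℱ.le T) le_rfl
  have hbound : ∀ s : ℝ, ∫⁻ ω, ENNReal.ofReal (Real.exp (s * Z ω)) ∂μ ≤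
      ENNReal.ofReal (Real.exp (n * sigmaBar σ ^ 2 * s ^ 2 / 2)) := fun s => by
    set c := s ^ 2 * sigmaBar σ ^ 2 / 2 with hc
    have hc0 : 0 ≤ c := by positivity
    calc _ ≤ ∫⁻ ω, ENNReal.ofReal (Real.exp (c * n)) * ENNReal.ofReal
          (Real.exp (s * Z ω - c * truncCount n (fun l => act l ω) a T)) ∂μ := by
          refine lintegral_mono fun ω => ?_
          rw [← ENNReal.ofReal_mul (Real.exp_pos _).le, ← Real.exp_add]
          refine ENNReal.ofReal_le_ofReal (Real.exp_le_exp.2 ?_)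
          have := mul_le_mul_of_nonneg_left
            (truncCount_le (fun l => act l ω) a hn hT) hc0
          linarith
      _ = ENNReal.ofReal (Real.exp (c * n)) * ∫⁻ ω, ENNReal.ofReal
          (Real.exp (s * Z ω - c * truncCount n (fun l => act l ω) a T)) ∂μ :=
          lintegral_const_mul' _ _ ENNReal.ofReal_ne_top
      _ ≤ ENNReal.ofReal (Real.exp (c * n)) * 1 := by
          gcongr
          exact h.lintegral_exp_truncSum_le hν a n s hT le_rfl
      _ = _ := by
          rw [mul_one, hc]
          congr 2
          ring
  have hexp : ∀ s : ℝ, AEStronglyMeasurable (fun ω => Real.exp (s * Z ω)) μ :=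
    fun s => ((hZ.const_mul s).exp).aestronglyMeasurable
  refine ⟨fun s => ⟨hexp s, ?_⟩, fun s => ?_⟩
  · rw [hasFiniteIntegral_iff_ofReal (ae_of_all _ fun _ => (Real.exp_pos _).le)]
    exact (hbound s).trans_lt ENNReal.ofReal_lt_top
  · rw [mgf, integral_eq_lintegral_of_nonneg_ae (ae_of_all _ fun _ => (Real.exp_pos _).le) (hexp s)]
    refine ENNReal.toReal_le_of_le_ofReal (Real.exp_pos _).le ?_
    simpa [Real.coe_toNNReal _ (sq_nonneg (sigmaBar σ))] using hbound s

/-- With the choice `L = ln (2AT/δ)`, all deviations stay within the confidence width with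
probability at least `1 - δ`. -/
lemma measureReal_not_concentrated_le (h : IsInteraction ν T μ ℱ act R C) (hν : MemClassOne σ ν)
    (hA : 0 < A) (hT : 1 ≤ T) (hσ : 0 < sigmaBar σ) {δ : ℝ} (hδ : 0 < δ) (hδ1 : δ < 1) :
    μ.real {ω | ¬ Concentrated (meanReward ν) (sigmaBar σ) (Real.log (2 * A * T / δ)) T
      (fun t => act t ω) (fun a t => C a t ω) (fun a t => R a t ω)} ≤ δ := by
  set L := Real.log (2 * A * T / δ) with hLdef
  have hA1 : (1 : ℝ) ≤ A := by exact_mod_cast hA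
  have hT1 : (1 : ℝ) ≤ T := by exact_mod_cast hT
  have hL : 0 ≤ L := Real.log_nonneg (by rw [le_div_iff₀ hδ]; nlinarith)
  set Z : Fin A → ℕ → Ω → ℝ := fun a n ω => truncSum (meanReward ν a) n (fun l => act l ω)
      (fun a l => C a l ω) (fun a l => R a l ω) a T
  set ε : ℕ → ℝ := fun n => sigmaBar σ * Real.sqrt (2 * L * n) with hε
  have htail : ∀ X : Ω → ℝ, ∀ n : ℕ, 1 ≤ n →
      HasSubgaussianMGF X (n * Real.toNNReal (sigmaBar σ ^ 2)) μ →
      μ.real {ω | ε n ≤ X ω} ≤ δ / (2 * A * T) := fun X n hn hX => by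
    have hn0 : (0 : ℝ) < n := by exact_mod_cast hn
    refine (hX.measure_ge_le (by positivity)).trans (le_of_eq ?_)
    -- The width is chosen so that the Chernoff exponent is `-L` for every `n`, and `exp (-L) =
    -- δ/(2AT)`.
    have : -ε n ^ 2 / (2 * ((n * Real.toNNReal (sigmaBar σ ^ 2) : NNReal) : ℝ)) = -L := by
      rw [NNReal.coe_mul, NNReal.coe_natCast, Real.coe_toNNReal _ (sq_nonneg _), hε]
      simp only
      rw [mul_pow, Real.sq_sqrt (by positivity)]
      field_simp
    rw [this, Real.exp_neg, hLdef, Real.exp_log (by positivity), inv_div]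
  have hsub : {ω | ¬ Concentrated (meanReward ν) (sigmaBar σ) L T
      (fun t => act t ω) (fun a t => C a t ω) (fun a t => R a t ω)} ⊆
      ⋃ p ∈ (Finset.univ : Finset (Fin A)) ×ˢ Finset.Icc 1 T,
        ({ω | ε p.2 ≤ Z p.1 p.2 ω} ∪ {ω | ε p.2 ≤ (-Z p.1 p.2) ω}) := by
    intro ω hω
    simp only [Concentrated, Set.mem_ofPred_eq, not_forall, not_le] at hω
    obtain ⟨a, t, ht, htT, hdev⟩ := hω
    obtain ⟨n, hn, hnt, hP⟩ := exists_pulls_eq (fun t => act t ω) a ht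
    rw [deviation_eq_truncSum _ _ _ _ a htT hP, hP] at hdev
    refine Set.mem_biUnion (x := (a, n)) (by simp; omega) ?_
    rcases le_abs.1 hdev.le with h1 | h1
    · exact Or.inl h1
    · exact Or.inr h1
  refine (measureReal_mono hsub (measure_ne_top μ _)).trans
    ((measureReal_biUnion_finset_le _ _).trans ?_)
  calc _ ≤ ∑ _p ∈ (Finset.univ : Finset (Fin A)) ×ˢ Finset.Icc 1 T,
        (δ / (2 * A * T) + δ / (2 * A * T)) := by
        refine Finset.sum_le_sum fun p hp => (measureReal_union_le _ _).trans ?_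
        have hn := (Finset.mem_Icc.1 (Finset.mem_product.1 hp).2).1
        have hsg := h.hasSubgaussianMGF_truncSum hν hT p.1 hn
        exact add_le_add (htail _ _ hn hsg) (htail _ _ hn hsg.neg)
    _ = δ := by
        rw [Finset.sum_const, Finset.card_product, Finset.card_univ, Fintype.card_fin, Nat.card_Icc,
          Nat.add_sub_cancel, nsmul_eq_mul, Nat.cast_mul]
        field_simp
        ring

end IsInteraction

/-! ### Absorbing the bias and final assembly -/

/-- The remainder of the regret bound. The maximum vanishes for large `T`. -/
noncomputable def remainder (A : ℕ) (sbar Kbar B : ℝ) (lam : ℕ → ℝ) (T : ℕ) : ℝ :=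
  A * B + max 0 (A * (lam T * (Kbar + B)) -
    2 * sbar * Real.sqrt (2 * A * T * Real.log (2 * A * T))) * ((T + lam T) / lam T)

/-- Uses only `2 ln 2 > 1`. -/
lemma sqrt_le_sqrt_mul_log {A T : ℝ} (hA : 1 ≤ A) (hT : 1 ≤ T) :
    Real.sqrt T ≤ Real.sqrt (2 * A * T * Real.log (2 * A * T)) := by
  have hlog : Real.log 2 ≤ Real.log (2 * A * T) := Real.log_le_log two_pos (by nlinarith)
  have h2 := Real.log_two_gt_d9
  refine Real.sqrt_le_sqrt ?_
  have h1 : (1 : ℝ) ≤ A * (2 * Real.log (2 * A * T)) := by nlinarith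
  nlinarith

lemma isLittleO_remainder {A : ℕ} (hA : 0 < A) {sbar : ℝ} (hs : 0 < sbar) (Kbar B : ℝ)
    {lam : ℕ → ℝ} (hlam_pos : ∀ T, 0 < lam T)
    (hlam : lam =o[atTop] fun T : ℕ => Real.sqrt T) :
    remainder A sbar Kbar B lam =o[atTop] fun T : ℕ => Real.sqrt T := by
  have hA1 : (1 : ℝ) ≤ A := by exact_mod_cast hA
  have hconst : (fun _ : ℕ => (A * B : ℝ)) =o[atTop] fun T : ℕ => Real.sqrt T :=
    isLittleO_const_left.2 (Or.inr (tendsto_norm_atTop_atTop.comp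
      (Real.tendsto_sqrt_atTop.comp tendsto_natCast_atTop_atTop)))
  refine hconst.congr' ?_ EventuallyEq.rfl
  -- The constant for which `λ_T ≤ c √T` puts the bias below the spare term; the `+ 1` keeps the
  -- denominator positive when `K̄ + B = 0`.
  have hc : 0 < 2 * sbar / (A * (|Kbar + B| + 1)) := by positivity
  filter_upwards [hlam.bound hc, eventually_ge_atTop 1] with T hT hT1
  have hT1' : (1 : ℝ) ≤ T := by exact_mod_cast hT1
  rw [Real.norm_of_nonneg (hlam_pos T).le, Real.norm_of_nonneg (Real.sqrt_nonneg _),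
    div_mul_eq_mul_div, le_div_iff₀ (by positivity)] at hT
  have hle : A * (lam T * (Kbar + B)) ≤
      2 * sbar * Real.sqrt (2 * A * T * Real.log (2 * A * T)) :=
    calc A * (lam T * (Kbar + B)) ≤ A * (lam T * (|Kbar + B| + 1)) := by
          have := (le_abs_self (Kbar + B)).trans (le_add_of_nonneg_right zero_le_one)
          exact mul_le_mul_of_nonneg_left (mul_le_mul_of_nonneg_left this (hlam_pos T).le)
            (by positivity)
      _ = lam T * (A * (|Kbar + B| + 1)) := by ring
      _ ≤ 2 * sbar * Real.sqrt T := hT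
      _ ≤ _ := mul_le_mul_of_nonneg_left (sqrt_le_sqrt_mul_log hA1 hT1') (by positivity)
  rw [remainder, max_eq_left (by linarith), zero_mul, add_zero]

variable {A : ℕ} {ν : Fin A → Measure (ℝ × Bool)}

lemma meanReward_le_bestMean (ν : Fin A → Measure (ℝ × Bool)) (a : Fin A) :
    meanReward ν a ≤ bestMean ν :=
  le_ciSup (Set.finite_range _).bddAbove a

lemma initRegret_le {Kbar B : ℝ} (hB : ∀ a, -B ≤ meanReward ν a) (hK : bestMean ν ≤ Kbar) :
    initRegret ν ≤ A * B + A * Kbar := by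
  calc initRegret ν ≤ ∑ _a : Fin A, (Kbar + B) :=
        Finset.sum_le_sum fun a _ => by linarith [hB a]
    _ = _ := by simp; ring

lemma sigmaBar_pos (hA : 0 < A) {σ : Fin A → ℝ} (hσ : ∀ a, 0 < σ a) : 0 < sigmaBar σ := by
  have h := sq_le_sigmaBar_sq σ ⟨0, hA⟩
  have h0 := hσ ⟨0, hA⟩
  exact lt_of_le_of_ne (sigmaBar_nonneg σ) fun h' => by
    rw [← h'] at h
    nlinarith

/-- The regret bound on a trajectory with concentrated deviations. -/
lemma initRegret_add_regret_le {act : ℕ → Fin A} {C : Fin A → ℕ → Bool} {R : Fin A → ℕ → ℝ}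
    {sbar Kbar B delta : ℝ} {lam : ℕ → ℝ} {T : ℕ} {qhat : ℕ → ℝ} (hA : 0 < A) (hs : 0 ≤ sbar)
    (hlam : 0 < lam T) (hδ : 0 < delta) (hδ1 : delta < 1) (hT : 1 ≤ T)
    (hB : ∀ a, -B ≤ meanReward ν a) (hK : bestMean ν ≤ Kbar)
    (hconc : Concentrated (meanReward ν) sbar (Real.log (2 * A * T / delta)) T act C R)
    (hucb : FollowsUCB sbar (lam T) Kbar delta T qhat act C R) :
    initRegret ν + regret ν T act ≤
      4 * sbar / qLam (lam T) T act C * Real.sqrt (2 * A * T * Real.log (2 * A * T / delta)) +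
        remainder A sbar Kbar B lam T + A * Kbar := by
  have hA1 : (1 : ℝ) ≤ A := by exact_mod_cast hA
  have hT1 : (1 : ℝ) ≤ T := by exact_mod_cast hT
  have h2AT : 1 ≤ 2 * (A : ℝ) * T := by nlinarith
  have hlog : Real.log (2 * A * T) ≤ Real.log (2 * A * T / delta) :=
    Real.log_le_log (by positivity) (le_div_self (by positivity) hδ hδ1.le)
  have hL : 0 ≤ Real.log (2 * A * T / delta) := (Real.log_nonneg h2AT).trans hlog
  have : Nonempty (Fin A) := ⟨⟨0, hA⟩⟩
  obtain ⟨b, hb⟩ := exists_eq_ciSup_of_finite (f := meanReward ν)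
  have hreg := sum_gap_le hA hs hlam hL (fun a => (meanReward_le_bestMean ν a).trans hK) hB
    hconc hucb hT b
  have hinit := initRegret_le hB hK
  rw [hb] at hreg
  change regret ν T act ≤ _ at hreg
  have hq := qLam_pos act C hA hlam hT
  have hqge := qLam_ge act C hA hlam hT
  rw [remainder]
  set q := qLam (lam T) T act C
  set X := Real.sqrt (2 * A * T * Real.log (2 * A * T / delta))
  set X₀ := Real.sqrt (2 * A * T * Real.log (2 * A * T))
  have hX : X₀ ≤ X := Real.sqrt_le_sqrt (by gcongr)
  have hinv : 1 / q ≤ (T + lam T) / lam T := by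
    rw [div_le_iff₀ (by positivity)] at hqge
    rw [div_le_div_iff₀ hq hlam]
    linarith
  -- The positive part is taken first so that `1/q` can then be enlarged. Passing from `X` to the
  -- smaller `X₀` removes `δ`, making the remainder uniform in it.
  have hslack : (A * (lam T * (Kbar + B)) - 2 * sbar * X) / q ≤
      max 0 (A * (lam T * (Kbar + B)) - 2 * sbar * X₀) * ((T + lam T) / lam T) :=
    calc _ = (A * (lam T * (Kbar + B)) - 2 * sbar * X) * (1 / q) := by ring
      _ ≤ max 0 (A * (lam T * (Kbar + B)) - 2 * sbar * X₀) * (1 / q) := by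
        gcongr
        refine le_max_of_le_right ?_
        gcongr
      _ ≤ _ := by gcongr
  have hsplit : (2 * sbar * X + A * (lam T * (Kbar + B))) / q =
      4 * sbar / q * X + (A * (lam T * (Kbar + B)) - 2 * sbar * X) / q := by ring
  linarith

end MissingBandit

theorem theorem1 (A : ℕ) (hA : 0 < A)
    (σ : Fin A → ℝ) (hσ : ∀ a, 0 < σ a)
    (Kbar B : ℝ)
    (lam : ℕ → ℝ) (hlam_pos : ∀ T, 0 < lam T)
    (hlam : lam =o[atTop] fun T : ℕ => Real.sqrt T)
    (κ : ℝ) (hκ : 0 < κ) :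
    ∃ (M : ℝ) (r : ℕ → ℝ), (r =o[atTop] fun T : ℕ => Real.sqrt T) ∧
      ∀ (δ₁ : ℝ), 0 < δ₁ → δ₁ < 1 →
      ∀ (T : ℕ), 1 ≤ T →
      ∀ (ν : Fin A → Measure (ℝ × Bool)), MissingBandit.MemClassOne σ ν →
        (∀ a, -B ≤ MissingBandit.meanReward ν a) →
        MissingBandit.bestMean ν ≤ Kbar →
      ∀ (Ω : Type*) [mΩ : MeasurableSpace Ω] (μ : Measure Ω) [IsProbabilityMeasure μ]
        (ℱ : Filtration ℕ mΩ) (act : ℕ → Ω → Fin A) (R : Fin A → ℕ → Ω → ℝ)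
        (C : Fin A → ℕ → Ω → Bool) (qhat : ℕ → Ω → ℝ),
        MissingBandit.IsInteraction ν T μ ℱ act R C →
        (∀ᵐ ω ∂μ, MissingBandit.FollowsUCB (MissingBandit.sigmaBar σ) (lam T) Kbar δ₁ T
          (fun t => qhat t ω) (fun t => act t ω) (fun a t => C a t ω) (fun a t => R a t ω)) →
        1 - δ₁ - M * (T : ℝ) ^ (-κ) ≤
          μ.real {ω | MissingBandit.initRegret ν + MissingBandit.regret ν T (fun t => act t ω) ≤
            4 * MissingBandit.sigmaBar σ /
                MissingBandit.qLam (lam T) T (fun t => act t ω) (fun a t => C a t ω) *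
              Real.sqrt (2 * A * T * Real.log (2 * A * T / δ₁)) +
            r T + A * Kbar} := by

  have hs := MissingBandit.sigmaBar_pos hA hσ
  refine ⟨0, MissingBandit.remainder A (MissingBandit.sigmaBar σ) Kbar B lam,
    MissingBandit.isLittleO_remainder hA hs Kbar B hlam_pos hlam, ?_⟩
  intro δ hδ hδ1 T hT ν hν hB hK Ω mΩ μ _ ℱ act R C qhat hint hucb
  have hbad := hint.measureReal_not_concentrated_le hν hA hT hs hδ hδ1
  set bad := {ω | ¬ MissingBandit.Concentrated (MissingBandit.meanReward ν)
    (MissingBandit.sigmaBar σ) (Real.log (2 * A * T / δ)) T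
    (fun t => act t ω) (fun a t => C a t ω) (fun a t => R a t ω)}
  set good := {ω | MissingBandit.initRegret ν + MissingBandit.regret ν T (fun t => act t ω) ≤
    4 * MissingBandit.sigmaBar σ /
        MissingBandit.qLam (lam T) T (fun t => act t ω) (fun a t => C a t ω) *
      Real.sqrt (2 * A * T * Real.log (2 * A * T / δ)) +
    MissingBandit.remainder A (MissingBandit.sigmaBar σ) Kbar B lam T + A * Kbar}
  have hcover : μ.real Set.univ ≤ μ.real (good ∪ bad) := by
    refine ENNReal.toReal_mono (measure_ne_top μ _) (measure_mono_ae ?_)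
    filter_upwards [hucb] with ω hω _
    by_cases hconc : ω ∈ bad
    · exact Or.inr hconc
    · exact Or.inl (MissingBandit.initRegret_add_regret_le hA hs.le (hlam_pos T) hδ hδ1 hT hB hK
        (not_not.1 hconc) hω)
  rw [probReal_univ] at hcover
  have := measureReal_union_le (μ := μ) good bad
  linarith
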